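/- Let $G$ be a group (for instance a finite group or a compact Lie group) and let $U$ be a unitary representation of $G$ on a finite-dimensional complex Hilbert space $\mathcal H$. Then $\mathcal H$ admits a decomposition into irreps, that is, a unitary identification $$\mathcal H\cong\bigoplus_\mu \mathcal M_\mu\otimes\mathcal N_\mu,\qquad U(g)\cong\bigoplus_\mu U_\mu(g)\otimes I_{\mathcal N_\mu}\quad(g\in G),$$ with finitely many labels $\mu$, where the $U_\mu$ are pairwise inequivalent irreducible unitary representations of $G$ on $\mathcal M_\mu$ and the $\mathcal N_\mu$ are finite-dimensional Hilbert spaces (multiplicity spaces). Fix any such decomposition, and let $\Pi_\mu$ be the projection of $\mathcal H$ onto $\mathcal M_\mu\otimes\mathcal N_\mu$. For unit vectors $\psi_1,\psi_2\in\mathcal H$ let $$F_i^{(\mu)}=\mathrm{tr}_{\mathcal N_\mu}\bigl(\Pi_\mu|\psi_i\rangle\langle\psi_i|\Pi_\mu\bigr)\qquad(i=1,2)$$ be their reductions onto irreps, which are operators on $\mathcal M_\mu$. Then there exists a $G$-invariant unitary $V$ on $\mathcal H$, i.e. a unitary with $VU(g)=U(g)V$ for all $g\in G$, such that $$|\langle\psi_2|V|\psi_1\rangle|\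 \ge\ 1-\frac12\sum_\mu\bigl\|F_1^{(\mu)}-F_2^{(\mu)}\bigr\|_1,$$ where $\|\cdot\|_1$ is the trace norm (the sum of the singular values). -/

import Mathlib

open scoped TensorProduct

universe u v

noncomputable section

/-- The linear representation underlying a unitary representation `U` of `G` on `H`;
unitary operators are linear isometric bijections `H ≃ₗᵢ[ℂ] H`. -/
def unitaryRepToRepresentation {G : Type v} [Group G] {H : Type u} [NormedAddCommGroup H]
    [InnerProductSpace ℂ H] (U : G →* (H ≃ₗᵢ[ℂ] H)) : Representation ℂ G H where
  toFun g := (U g).toLinearEquiv.toLinearMap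
  map_one' := by ext x; simp
  map_mul' g h := by ext x; simp

/-- A unitary operator `V` is `G`-invariant if `V U(g) = U(g) V` for all `g`. -/
def IsGInvariantUnitary {G : Type v} [Group G] {H : Type u} [NormedAddCommGroup H]
    [InnerProductSpace ℂ H] (U : G →* (H ≃ₗᵢ[ℂ] H)) (V : H ≃ₗᵢ[ℂ] H) : Prop :=
  ∀ g : G, V * U g = U g * V

/-- A decomposition `H ≅ ⨁_μ M_μ ⊗ N_μ`, `U(g) ≅ ⨁_μ U_μ(g) ⊗ 1`, of a unitary representation into
irreps: the `U_μ` are pairwise inequivalent irreducible unitary representations on `M_μ`, and the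
`N_μ` are the multiplicity spaces. -/
structure IrrepDecomposition {G : Type v} [Group G] {H : Type u} [NormedAddCommGroup H]
    [InnerProductSpace ℂ H] (U : G →* (H ≃ₗᵢ[ℂ] H)) where
  ι : Type u
  [fintypeι : Fintype ι]
  [decEqι : DecidableEq ι]
  M : ι → Type u
  N : ι → Type u
  [normedM : ∀ μ, NormedAddCommGroup (M μ)]
  [innerM : ∀ μ, InnerProductSpace ℂ (M μ)]
  [finM : ∀ μ, FiniteDimensional ℂ (M μ)]
  [normedN : ∀ μ, NormedAddCommGroup (N μ)]
  [innerN : ∀ μ, InnerProductSpace ℂ (N μ)]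
  [finN : ∀ μ, FiniteDimensional ℂ (N μ)]
  irrep : ∀ μ, G →* (M μ ≃ₗᵢ[ℂ] M μ)
  irreducible : ∀ μ, (unitaryRepToRepresentation (irrep μ)).IsIrreducible
  inequivalent : ∀ μ ν, μ ≠ ν →
    IsEmpty ((unitaryRepToRepresentation (irrep μ)).Equiv (unitaryRepToRepresentation (irrep ν)))
  iso : H ≃ₗᵢ[ℂ] PiLp 2 (fun μ => M μ ⊗[ℂ] N μ)
  iso_apply : ∀ (g : G) (x : H) (μ : ι),
    iso (U g x) μ =
      TensorProduct.map (irrep μ g).toLinearEquiv.toLinearMap LinearMap.id (iso x μ)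

attribute [instance] IrrepDecomposition.fintypeι IrrepDecomposition.decEqι
  IrrepDecomposition.normedM IrrepDecomposition.innerM IrrepDecomposition.finM
  IrrepDecomposition.normedN IrrepDecomposition.innerN IrrepDecomposition.finN

/-- The partial trace `tr_N` of operators on `M ⊗ N`: the linear map with
`A ⊗ B ↦ tr(B) A`. -/
def partialTraceRight (M N : Type u) [AddCommGroup M] [Module ℂ M] [FiniteDimensional ℂ M]
    [AddCommGroup N] [Module ℂ N] [FiniteDimensional ℂ N] :
    (M ⊗[ℂ] N →ₗ[ℂ] M ⊗[ℂ] N) →ₗ[ℂ] (M →ₗ[ℂ] M) :=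
  (TensorProduct.rid ℂ (M →ₗ[ℂ] M)).toLinearMap ∘ₗ
    LinearMap.lTensor (M →ₗ[ℂ] M) (LinearMap.trace ℂ N) ∘ₗ
    (homTensorHomEquiv ℂ M N M N).symm.toLinearMap

theorem partialTraceRight_map (M N : Type u) [AddCommGroup M] [Module ℂ M] [FiniteDimensional ℂ M]
    [AddCommGroup N] [Module ℂ N] [FiniteDimensional ℂ N] (A : M →ₗ[ℂ] M) (B : N →ₗ[ℂ] N) :
    partialTraceRight M N (TensorProduct.map A B) = LinearMap.trace ℂ N B • A := by
  have h : (homTensorHomEquiv ℂ M N M N).symm (TensorProduct.map A B) = A ⊗ₜ[ℂ] B := by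
    rw [LinearEquiv.symm_apply_eq]; simp
  simp [partialTraceRight, h]

/-- The trace norm `‖T‖₁ = tr √(T†T)`: the sum of the singular values of `T`. -/
def traceNorm {E : Type u} [NormedAddCommGroup E] [InnerProductSpace ℂ E] [FiniteDimensional ℂ E]
    (T : E →ₗ[ℂ] E) : ℝ :=
  ∑ i ∈ Finset.range (Module.finrank ℂ E), T.singularValues i

/-- The density operator `|ψ⟩⟨ψ|`. -/
def pureState {H : Type u} [NormedAddCommGroup H] [InnerProductSpace ℂ H] (ψ : H) : H →ₗ[ℂ] H :=
  (InnerProductSpace.rankOne ℂ ψ ψ).toLinearMap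

namespace IrrepDecomposition

/-- The embedding of the sector `M_μ ⊗ N_μ` into `H`. -/
def ofSector {G : Type v} [Group G] {H : Type u} [NormedAddCommGroup H]
    [InnerProductSpace ℂ H] {U : G →* (H ≃ₗᵢ[ℂ] H)} (D : IrrepDecomposition U) (μ : D.ι) :
    D.M μ ⊗[ℂ] D.N μ →ₗ[ℂ] H :=
  D.iso.symm.toLinearEquiv.toLinearMap ∘ₗ
    (WithLp.linearEquiv 2 ℂ (∀ ν, D.M ν ⊗[ℂ] D.N ν)).symm.toLinearMap ∘ₗ
    LinearMap.single ℂ (fun ν => D.M ν ⊗[ℂ] D.N ν) μ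

/-- The component in the sector `M_μ ⊗ N_μ` of a vector of `H` (the adjoint of `ofSector`). -/
def toSector {G : Type v} [Group G] {H : Type u} [NormedAddCommGroup H]
    [InnerProductSpace ℂ H] {U : G →* (H ≃ₗᵢ[ℂ] H)} (D : IrrepDecomposition U) (μ : D.ι) :
    H →ₗ[ℂ] D.M μ ⊗[ℂ] D.N μ :=
  LinearMap.proj μ ∘ₗ (WithLp.linearEquiv 2 ℂ (∀ ν, D.M ν ⊗[ℂ] D.N ν)).toLinearMap ∘ₗ
    D.iso.toLinearEquiv.toLinearMap

/-- The projection `Π_μ` of `H` onto the sector of the irrep `μ`. -/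
def sectorProj {G : Type v} [Group G] {H : Type u} [NormedAddCommGroup H]
    [InnerProductSpace ℂ H] {U : G →* (H ≃ₗᵢ[ℂ] H)} (D : IrrepDecomposition U) (μ : D.ι) :
    H →ₗ[ℂ] H :=
  D.ofSector μ ∘ₗ D.toSector μ

/-- The reduction `tr_{N_μ}(Π_μ ρ Π_μ)` of `ρ` onto the irrep `μ`, where `Π_μ ρ Π_μ` is regarded as
an operator on the sector `M_μ ⊗ N_μ`. -/
def reduction {G : Type v} [Group G] {H : Type u} [NormedAddCommGroup H]
    [InnerProductSpace ℂ H] {U : G →* (H ≃ₗᵢ[ℂ] H)} (D : IrrepDecomposition U)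
    (ρ : H →ₗ[ℂ] H) (μ : D.ι) : D.M μ →ₗ[ℂ] D.M μ :=
  partialTraceRight (D.M μ) (D.N μ)
    (D.toSector μ ∘ₗ (D.sectorProj μ ∘ₗ ρ ∘ₗ D.sectorProj μ) ∘ₗ D.ofSector μ)

end IrrepDecomposition

end

/-!
A decomposition exists because `H` is an orthogonal sum of minimal invariant subspaces, and by
Schur's lemma an intertwiner between equivalent irreps is a multiple of a unitary, so that the
summands in one equivalence class can be identified unitarily with a fixed one of them.

For the bound, `V` is taken of the form `⨁_μ 1 ⊗ V_μ`, which reduces the claim to one sector. There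
the components of `ψ₁` and `ψ₂` are operators `X Y : N → M`, the reductions are `X X†` and `Y Y†`,
and a unitary `V_μ` on `N` turns the overlap into `tr (Y† X W)` with `W` an arbitrary unitary. As in
Uhlmann's theorem, the best `W` gives `‖Y† X‖₁`, which by the polar decompositions of `X†` and `Y†`
is at least `tr (A B)` with `A = √(X X†)` and `B = √(Y Y†)`. Finally
`2 tr (A B) = tr A² + tr B² - tr (A - B)²`, and `tr (A - B)² ≤ ‖A² - B²‖₁` is the Powers–Størmer
inequality.
-/

noncomputable section SingularValues

variable {𝕜 E F : Type*} [RCLike 𝕜] [NormedAddCommGroup E] [InnerProductSpace 𝕜 E]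
  [NormedAddCommGroup F] [InnerProductSpace 𝕜 F]

theorem norm_sum_sq_of_pairwise_inner_eq_zero {ι : Type*} [Fintype ι] {w : ι → F}
    (hw : Pairwise fun i j => inner 𝕜 (w i) (w j) = 0) :
    ‖∑ i, w i‖ ^ 2 = ∑ i, ‖w i‖ ^ 2 := by
  have hinner : inner 𝕜 (∑ i, w i) (∑ i, w i) = ∑ i, inner 𝕜 (w i) (w i) := by
    rw [sum_inner]
    refine Finset.sum_congr rfl fun i _ => ?_
    rw [inner_sum, Finset.sum_eq_single i (fun j _ hj => hw hj.symm) (by simp)]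
  simp only [inner_self_eq_norm_sq_to_K] at hinner
  exact_mod_cast hinner

theorem norm_constr_apply_le {ι : Type*} [Fintype ι] (e : OrthonormalBasis ι 𝕜 E) {w : ι → F}
    (hw : Pairwise fun i j => inner 𝕜 (w i) (w j) = 0) (hw₁ : ∀ i, ‖w i‖ ≤ 1) (x : E) :
    ‖e.toBasis.constr 𝕜 w x‖ ≤ ‖x‖ := by
  refine le_of_sq_le_sq ?_ (norm_nonneg x)
  calc ‖e.toBasis.constr 𝕜 w x‖ ^ 2
      = ∑ i, ‖e.repr x i • w i‖ ^ 2 := by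
        rw [Module.Basis.constr_apply_fintype, ← norm_sum_sq_of_pairwise_inner_eq_zero (𝕜 := 𝕜)]
        · simp
        · intro i j hij
          rw [inner_smul_left, inner_smul_right, hw hij, mul_zero, mul_zero]
    _ ≤ ∑ i, ‖e.repr x i‖ ^ 2 := by
        gcongr with i
        rw [norm_smul]
        exact mul_le_of_le_one_right (norm_nonneg _) (hw₁ i)
    _ = ‖x‖ ^ 2 := by rw [← EuclideanSpace.norm_sq_eq, e.repr.norm_map]

theorem isPositive_of_apply_eq_smul {ι : Type*} [Fintype ι] (e : OrthonormalBasis ι 𝕜 E)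
    {A : E →ₗ[𝕜] E} {d : ι → ℝ} (hd : ∀ i, 0 ≤ d i) (hA : ∀ i, A (e i) = (d i : 𝕜) • e i) :
    A.IsPositive := by
  have hsum : A = ∑ i, (d i : 𝕜) • (InnerProductSpace.rankOne 𝕜 (e i) (e i)).toLinearMap := by
    ext x
    conv_lhs => rw [← e.sum_repr' x]
    simp only [map_sum, map_smul, hA, LinearMap.sum_apply, LinearMap.smul_apply,
      ContinuousLinearMap.coe_coe, InnerProductSpace.rankOne_apply]
    exact Finset.sum_congr rfl fun i _ => smul_comm _ _ _
  rw [hsum]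
  exact LinearMap.isPositive_sum _ fun i _ =>
    (InnerProductSpace.isPositive_rankOne_self (e i)).toLinearMap.smul_of_nonneg
      (RCLike.ofReal_nonneg.2 (hd i))

variable [FiniteDimensional 𝕜 E] [FiniteDimensional 𝕜 F]

theorem norm_adjoint_apply_le {C : E →ₗ[𝕜] F} (hC : ∀ x, ‖C x‖ ≤ ‖x‖) (y : F) :
    ‖LinearMap.adjoint C y‖ ≤ ‖y‖ := by
  rcases (norm_nonneg (LinearMap.adjoint C y)).eq_or_lt' with h | h
  · rw [h]
    exact norm_nonneg y
  refine le_of_mul_le_mul_right ?_ h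
  calc ‖LinearMap.adjoint C y‖ * ‖LinearMap.adjoint C y‖
      = ‖inner 𝕜 y (C (LinearMap.adjoint C y))‖ := by
        rw [← LinearMap.adjoint_inner_left, ← inner_self_re_eq_norm,
          inner_self_eq_norm_mul_norm]
    _ ≤ ‖y‖ * ‖C (LinearMap.adjoint C y)‖ := norm_inner_le_norm _ _
    _ ≤ ‖y‖ * ‖LinearMap.adjoint C y‖ := by gcongr; exact hC _

/-- An orthonormal basis of right singular vectors of `T`, that is, of eigenvectors of `T† T`;
the `i`-th one belongs to the `i`-th singular value. -/
def rightSingularBasis (T : E →ₗ[𝕜] F) :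
    OrthonormalBasis (Fin (Module.finrank 𝕜 E)) 𝕜 E :=
  T.isSymmetric_adjoint_comp_self.eigenvectorBasis rfl

/-- The left singular vectors `σᵢ⁻¹ T vᵢ` of `T`, where `vᵢ` is the `i`-th right singular vector.
Those with `σᵢ = 0` are `0`, so that the family is orthogonal but not necessarily orthonormal. -/
def leftSingularVector (T : E →ₗ[𝕜] F) (i : Fin (Module.finrank 𝕜 E)) : F :=
  (T.singularValues i : 𝕜)⁻¹ • T (rightSingularBasis T i)

theorem adjoint_apply_apply_rightSingularBasis (T : E →ₗ[𝕜] F) (i : Fin (Module.finrank 𝕜 E)) :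
    LinearMap.adjoint T (T (rightSingularBasis T i)) =
      (T.singularValues i : 𝕜) ^ 2 • rightSingularBasis T i := by
  rw [← LinearMap.comp_apply, rightSingularBasis,
    LinearMap.IsSymmetric.apply_eigenvectorBasis, ← T.sq_singularValues_fin rfl]
  simp

theorem inner_apply_rightSingularBasis (T : E →ₗ[𝕜] F) (i j : Fin (Module.finrank 𝕜 E)) :
    inner 𝕜 (T (rightSingularBasis T i)) (T (rightSingularBasis T j)) =
      if i = j then (T.singularValues i : 𝕜) ^ 2 else 0 := by
  rw [← LinearMap.adjoint_inner_right, adjoint_apply_apply_rightSingularBasis, inner_smul_right,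
    OrthonormalBasis.inner_eq_ite]
  split_ifs with hij
  · rw [hij, mul_one]
  · rw [mul_zero]

theorem norm_apply_rightSingularBasis (T : E →ₗ[𝕜] F) (i : Fin (Module.finrank 𝕜 E)) :
    ‖T (rightSingularBasis T i)‖ = T.singularValues i := by
  have hsq := inner_apply_rightSingularBasis T i i
  rw [if_pos rfl, inner_self_eq_norm_sq_to_K] at hsq
  rw [← sq_eq_sq₀ (norm_nonneg _) (T.singularValues_nonneg _)]
  exact RCLike.ofReal_injective (K := 𝕜) (by push_cast; exact hsq)

theorem apply_rightSingularBasis (T : E →ₗ[𝕜] F) (i : Fin (Module.finrank 𝕜 E)) :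
    T (rightSingularBasis T i) = (T.singularValues i : 𝕜) • leftSingularVector T i := by
  by_cases hi : T.singularValues i = 0
  · rw [hi, RCLike.ofReal_zero, zero_smul, ← norm_eq_zero, norm_apply_rightSingularBasis, hi]
  · rw [leftSingularVector, smul_inv_smul₀ (by exact_mod_cast hi)]

theorem adjoint_apply_leftSingularVector (T : E →ₗ[𝕜] F) (i : Fin (Module.finrank 𝕜 E)) :
    LinearMap.adjoint T (leftSingularVector T i) =
      (T.singularValues i : 𝕜) • rightSingularBasis T i := by
  rw [leftSingularVector, map_smul, adjoint_apply_apply_rightSingularBasis, smul_smul]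
  congr 1
  by_cases hi : (T.singularValues i : 𝕜) = 0
  · simp [hi]
  · field_simp

theorem inner_leftSingularVector (T : E →ₗ[𝕜] F) (i j : Fin (Module.finrank 𝕜 E)) :
    inner 𝕜 (leftSingularVector T i) (leftSingularVector T j) =
      if i = j ∧ T.singularValues i ≠ 0 then 1 else 0 := by
  simp only [leftSingularVector, inner_smul_left, inner_smul_right,
    inner_apply_rightSingularBasis]
  rcases eq_or_ne i j with rfl | hij
  · by_cases hi : T.singularValues i = 0
    · simp [hi]
    · have hi' : (T.singularValues i : 𝕜) ≠ 0 := by exact_mod_cast hi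
      simp only [if_true, map_inv₀, RCLike.conj_ofReal, ne_eq, hi, not_false_eq_true, and_self]
      field_simp
  · simp [hij]

theorem norm_leftSingularVector_le_one (T : E →ₗ[𝕜] F) (i : Fin (Module.finrank 𝕜 E)) :
    ‖leftSingularVector T i‖ ≤ 1 := by
  rw [← sq_le_one_iff₀ (norm_nonneg _), ← inner_self_eq_norm_sq (𝕜 := 𝕜),
    inner_leftSingularVector]
  split_ifs <;> simp

theorem exists_orthonormalBasis_eq_leftSingularVector (T : E →ₗ[𝕜] E) :
    ∃ w : OrthonormalBasis (Fin (Module.finrank 𝕜 E)) 𝕜 E,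
      ∀ i : Fin (Module.finrank 𝕜 E), T.singularValues i ≠ 0 → w i = leftSingularVector T i := by
  let s : Set (Fin (Module.finrank 𝕜 E)) := {i | T.singularValues i ≠ 0}
  have hs : Orthonormal 𝕜 (s.domRestrict (leftSingularVector T)) := by
    rw [orthonormal_iff_ite]
    rintro ⟨i, hi⟩ ⟨j, -⟩
    simp [inner_leftSingularVector, show T.singularValues i ≠ 0 from hi]
  exact hs.exists_orthonormalBasis_extension_of_card_eq (by simp)

theorem exists_polarDecomposition (T : E →ₗ[𝕜] F) :
    ∃ C : E →ₗ[𝕜] F, (∀ x, ‖C x‖ ≤ ‖x‖) ∧ (LinearMap.adjoint T ∘ₗ C).IsPositive ∧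
      (LinearMap.adjoint T ∘ₗ C) ∘ₗ (LinearMap.adjoint T ∘ₗ C) = LinearMap.adjoint T ∘ₗ T := by
  set v := rightSingularBasis T with hv
  set C : E →ₗ[𝕜] F := v.toBasis.constr 𝕜 (leftSingularVector T)
  have hCv : ∀ i, LinearMap.adjoint T (C (v i)) = (T.singularValues i : 𝕜) • v i := by
    intro i
    rw [← v.coe_toBasis, Module.Basis.constr_basis, adjoint_apply_leftSingularVector,
      v.coe_toBasis]
  refine ⟨C, norm_constr_apply_le v ?_ (norm_leftSingularVector_le_one T),
    isPositive_of_apply_eq_smul v (fun i => T.singularValues_nonneg i) hCv, ?_⟩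
  · intro i j hij
    simp [inner_leftSingularVector, hij]
  · refine v.toBasis.ext fun i => ?_
    simp only [v.coe_toBasis, LinearMap.comp_apply, hCv, map_smul]
    rw [hv, adjoint_apply_apply_rightSingularBasis, smul_smul, sq]

end SingularValues

section TraceNorm

variable {E : Type*} [NormedAddCommGroup E] [InnerProductSpace ℂ E] [FiniteDimensional ℂ E]

theorem norm_trace_comp_le_traceNorm (T : E →ₗ[ℂ] E) {C : E →ₗ[ℂ] E}
    (hC : ∀ x, ‖C x‖ ≤ ‖x‖) : ‖LinearMap.trace ℂ E (T ∘ₗ C)‖ ≤ traceNorm T := by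
  rw [LinearMap.trace_comp_comm', LinearMap.trace_eq_sum_inner _ (rightSingularBasis T),
    traceNorm, Finset.sum_range]
  refine norm_sum_le_of_le _ fun i _ => ?_
  calc ‖inner ℂ (rightSingularBasis T i) (C (T (rightSingularBasis T i)))‖
      ≤ ‖rightSingularBasis T i‖ * ‖C (T (rightSingularBasis T i))‖ := norm_inner_le_norm _ _
    _ ≤ ‖T (rightSingularBasis T i)‖ := by
        rw [OrthonormalBasis.norm_eq_one, one_mul]
        exact hC _
    _ = T.singularValues i := norm_apply_rightSingularBasis T i

theorem exists_unitary_trace_comp_eq_traceNorm (T : E →ₗ[ℂ] E) :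
    ∃ W : E ≃ₗᵢ[ℂ] E,
      LinearMap.trace ℂ E (T ∘ₗ W.toLinearEquiv.toLinearMap) = traceNorm T := by
  obtain ⟨w, hw⟩ := exists_orthonormalBasis_eq_leftSingularVector T
  have hT : ∀ i : Fin (Module.finrank ℂ E),
      T (rightSingularBasis T i) = (T.singularValues i : ℂ) • w i := by
    intro i
    rw [apply_rightSingularBasis]
    by_cases hi : T.singularValues i = 0
    · simp [hi]
    · rw [hw i hi]
      rfl
  refine ⟨w.equiv (rightSingularBasis T) (Equiv.refl _), ?_⟩
  rw [LinearMap.trace_eq_sum_inner _ w, traceNorm, Finset.sum_range, Complex.ofReal_sum]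
  refine Finset.sum_congr rfl fun i _ => ?_
  rw [LinearMap.comp_apply]
  simp only [LinearEquiv.coe_coe, LinearIsometryEquiv.coe_toLinearEquiv,
    OrthonormalBasis.equiv_apply_basis, Equiv.refl_apply, hT, inner_smul_right]
  simp

theorem sum_norm_inner_apply_le_traceNorm {κ : Type*} [Fintype κ] (e : OrthonormalBasis κ ℂ E)
    (T : E →ₗ[ℂ] E) : ∑ k, ‖inner ℂ (e k) (T (e k))‖ ≤ traceNorm T := by
  set v := rightSingularBasis T
  have hexpand : ∀ k, inner ℂ (e k) (T (e k)) =
      ∑ i, inner ℂ (v i) (e k) * inner ℂ (e k) (T (v i)) := by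
    intro k
    rw [← LinearMap.adjoint_inner_left, ← v.sum_inner_mul_inner]
    simp only [LinearMap.adjoint_inner_left, mul_comm]
  calc ∑ k, ‖inner ℂ (e k) (T (e k))‖
      ≤ ∑ k, ∑ i, ‖inner ℂ (e k) (v i)‖ * ‖inner ℂ (e k) (T (v i))‖ := by
        refine Finset.sum_le_sum fun k _ => ?_
        rw [hexpand]
        refine norm_sum_le_of_le _ fun i _ => ?_
        rw [norm_mul, norm_inner_symm]
    _ = ∑ i, ∑ k, ‖inner ℂ (e k) (v i)‖ * ‖inner ℂ (e k) (T (v i))‖ := Finset.sum_comm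
    _ ≤ ∑ i : Fin (Module.finrank ℂ E), ‖v i‖ * ‖T (v i)‖ := by
        refine Finset.sum_le_sum fun i _ => (Real.sum_mul_le_sqrt_mul_sqrt _ _ _).trans_eq ?_
        rw [e.sum_sq_norm_inner_right, e.sum_sq_norm_inner_right, Real.sqrt_sq (norm_nonneg _),
          Real.sqrt_sq (norm_nonneg _)]
    _ = traceNorm T := by
        simp only [v, OrthonormalBasis.norm_eq_one, norm_apply_rightSingularBasis, one_mul,
          traceNorm, Finset.sum_range]

end TraceNorm

section PowersStormer

variable {E : Type*} [NormedAddCommGroup E] [InnerProductSpace ℂ E]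

theorem sq_eigenvalue_sub_le_norm_inner {A B : E →ₗ[ℂ] E} (hA : A.IsPositive)
    (hB : B.IsPositive) {e : E} (he : ‖e‖ = 1) {d : ℝ} (hd : (A - B) e = (d : ℂ) • e) :
    d ^ 2 ≤ ‖inner ℂ e ((A ∘ₗ A - B ∘ₗ B) e)‖ := by
  set a := (inner ℂ e (A e)).re
  set b := (inner ℂ e (B e)).re
  have ha : 0 ≤ a := hA.re_inner_nonneg_right e
  have hb : 0 ≤ b := hB.re_inner_nonneg_right e
  have hab : d = a - b := by
    rw [← Complex.sub_re, ← inner_sub_right, ← LinearMap.sub_apply, hd, inner_smul_right,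
      inner_self_eq_norm_sq_to_K, he]
    simp
  have hsplit : (A ∘ₗ A - B ∘ₗ B) e = A ((A - B) e) + (A - B) (B e) := by simp
  have hre : (inner ℂ e ((A ∘ₗ A - B ∘ₗ B) e)).re = d * (a + b) := by
    rw [hsplit, inner_add_right, hd, map_smul, inner_smul_right,
      ← (hA.isSymmetric.sub hB.isSymmetric) e, hd, inner_smul_left, Complex.conj_ofReal,
      ← mul_add, Complex.re_ofReal_mul, Complex.add_re]
  calc d ^ 2 = |d| * |a - b| := by rw [← hab, ← sq_abs, sq]
    _ ≤ |d| * |a + b| := by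
        refine mul_le_mul_of_nonneg_left ?_ (abs_nonneg d)
        rw [abs_of_nonneg (add_nonneg ha hb), abs_le]
        constructor <;> linarith
    _ = |(inner ℂ e ((A ∘ₗ A - B ∘ₗ B) e)).re| := by rw [hre, abs_mul]
    _ ≤ ‖inner ℂ e ((A ∘ₗ A - B ∘ₗ B) e)‖ := Complex.abs_re_le_norm _

variable [FiniteDimensional ℂ E]

theorem re_trace_sub_comp_self_le_traceNorm {A B : E →ₗ[ℂ] E} (hA : A.IsPositive)
    (hB : B.IsPositive) :
    (LinearMap.trace ℂ E ((A - B) ∘ₗ (A - B))).re ≤ traceNorm (A ∘ₗ A - B ∘ₗ B) := by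
  have hAB : (A - B).IsSymmetric := hA.isSymmetric.sub hB.isSymmetric
  set e := hAB.eigenvectorBasis rfl
  have he : ∀ i, (A - B) (e i) = (hAB.eigenvalues rfl i : ℂ) • e i :=
    hAB.apply_eigenvectorBasis rfl
  calc (LinearMap.trace ℂ E ((A - B) ∘ₗ (A - B))).re = ∑ i, hAB.eigenvalues rfl i ^ 2 := by
        rw [LinearMap.trace_eq_sum_inner _ e, Complex.re_sum]
        refine Finset.sum_congr rfl fun i _ => ?_
        rw [LinearMap.comp_apply, he, map_smul, he, smul_smul, inner_smul_right,
          inner_self_eq_norm_sq_to_K, e.norm_eq_one]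
        simp [sq]
    _ ≤ ∑ i, ‖inner ℂ (e i) ((A ∘ₗ A - B ∘ₗ B) (e i))‖ :=
        Finset.sum_le_sum fun i _ =>
          sq_eigenvalue_sub_le_norm_inner hA hB (e.norm_eq_one i) (he i)
    _ ≤ traceNorm (A ∘ₗ A - B ∘ₗ B) := sum_norm_inner_apply_le_traceNorm e _

theorem half_sub_traceNorm_le_traceNorm_comp_adjoint {F : Type*} [NormedAddCommGroup F]
    [InnerProductSpace ℂ F] [FiniteDimensional ℂ F] (S T : E →ₗ[ℂ] F) :
    1 / 2 * ((LinearMap.trace ℂ E (LinearMap.adjoint S ∘ₗ S)).re +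
        (LinearMap.trace ℂ E (LinearMap.adjoint T ∘ₗ T)).re -
        traceNorm (LinearMap.adjoint S ∘ₗ S - LinearMap.adjoint T ∘ₗ T)) ≤
      traceNorm (T ∘ₗ LinearMap.adjoint S) := by
  obtain ⟨C, hC, hA, hAA⟩ := exists_polarDecomposition S
  obtain ⟨D, hD, hB, hBB⟩ := exists_polarDecomposition T
  set A := LinearMap.adjoint S ∘ₗ C
  set B := LinearMap.adjoint T ∘ₗ D with hBdef
  have htr : LinearMap.trace ℂ E (B ∘ₗ A) =
      LinearMap.trace ℂ F ((T ∘ₗ LinearMap.adjoint S) ∘ₗ (C ∘ₗ LinearMap.adjoint D)) := by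
    rw [← hB.adjoint_eq, hBdef, LinearMap.adjoint_comp, LinearMap.adjoint_adjoint,
      LinearMap.comp_assoc, LinearMap.trace_comp_comm']
    rfl
  have hfidelity : (LinearMap.trace ℂ E (B ∘ₗ A)).re ≤ traceNorm (T ∘ₗ LinearMap.adjoint S) := by
    rw [htr]
    exact (Complex.re_le_norm _).trans (norm_trace_comp_le_traceNorm _ fun x =>
      (hC _).trans (norm_adjoint_apply_le hD x))
  have hPS := re_trace_sub_comp_self_le_traceNorm hA hB
  rw [LinearMap.sub_comp, LinearMap.comp_sub, LinearMap.comp_sub, map_sub, map_sub, map_sub,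
    LinearMap.trace_comp_comm' B A, hAA, hBB] at hPS
  simp only [Complex.sub_re] at hPS
  linarith

end PowersStormer

noncomputable section TensorVectors

variable {M N : Type*} [NormedAddCommGroup M] [InnerProductSpace ℂ M]
  [NormedAddCommGroup N] [InnerProductSpace ℂ N]

theorem inner_antiunitary_apply (J : N ≃ₗᵢ⋆[ℂ] N) (x y : N) :
    inner ℂ (J x) (J y) = inner ℂ y x := by
  have hI : Complex.I • J y = J (-(Complex.I • y)) := by simp [map_smulₛₗ]
  rw [← inner_conj_symm y x, inner_eq_sum_norm_sq_div_four, inner_eq_sum_norm_sq_div_four x y,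
    RCLike.I_to_complex, hI]
  simp only [← map_add, ← map_sub, J.norm_map, sub_neg_eq_add, ← sub_eq_add_neg]
  simp only [map_div₀, map_add, map_sub, map_mul, map_pow, map_ofNat, Complex.conj_I,
    RCLike.ofReal_eq_complex_ofReal, Complex.conj_ofReal]
  ring

theorem nonempty_antiunitary [FiniteDimensional ℂ N] : Nonempty (N ≃ₗᵢ⋆[ℂ] N) := by
  let c := stdOrthonormalBasis ℂ N
  let J : N →ₗ⋆[ℂ] N :=
    { toFun := fun x => ∑ i, inner ℂ x (c i) • c i
      map_add' := by simp [add_smul, Finset.sum_add_distrib]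
      map_smul' := fun z x => by
        simp only [inner_smul_left, mul_smul, Finset.smul_sum] }
  have hJ : ∀ i x, inner ℂ (c i) (J x) = inner ℂ x (c i) := by
    intro i x
    simp only [J, LinearMap.coe_mk, AddHom.coe_mk, inner_sum, inner_smul_right, c.inner_eq_ite]
    simp
  have hinvol : Function.Involutive J := by
    refine fun x => c.repr.injective (PiLp.ext fun i => ?_)
    rw [c.repr_apply_apply, c.repr_apply_apply, hJ, ← inner_conj_symm, hJ, inner_conj_symm]
  refine ⟨LinearEquiv.ofInvolutive J hinvol, fun x => ?_⟩
  rw [← sq_eq_sq₀ (norm_nonneg _) (norm_nonneg _), ← c.sum_sq_norm_inner_right,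
    ← c.sum_sq_norm_inner_right x]
  refine Finset.sum_congr rfl fun i _ => ?_
  change ‖inner ℂ (c i) (J x)‖ ^ 2 = _
  rw [hJ, norm_inner_symm]

theorem norm_sum_tmul_orthonormalBasis_sq {κ : Type*} [Fintype κ] (c : OrthonormalBasis κ ℂ N)
    (a : κ → M) : ‖∑ j, a j ⊗ₜ[ℂ] c j‖ ^ 2 = ∑ j, ‖a j‖ ^ 2 := by
  rw [norm_sum_sq_of_pairwise_inner_eq_zero (𝕜 := ℂ)]
  · simp only [TensorProduct.norm_tmul, c.norm_eq_one, mul_one]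
  · intro i j hij
    rw [TensorProduct.inner_tmul, c.inner_eq_zero hij, mul_zero]

/-- The correspondence between vectors of `M ⊗ N` and operators `N → M` given by
`m ⊗ n ↦ |m⟩⟨J n|`. The antiunitary `J` makes the bra depend linearly on `n`. -/
def operatorOfTensor (J : N ≃ₗᵢ⋆[ℂ] N) : M ⊗[ℂ] N →ₗ[ℂ] N →ₗ[ℂ] M :=
  TensorProduct.lift <| LinearMap.mk₂ ℂ
    (fun m n => (InnerProductSpace.rankOne ℂ m (J n)).toLinearMap)
    (by intros; simp) (by intros; simp) (by intros; simp)
    (by intros; simp [map_smulₛₗ])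

theorem operatorOfTensor_tmul (J : N ≃ₗᵢ⋆[ℂ] N) (m : M) (n : N) :
    operatorOfTensor J (m ⊗ₜ[ℂ] n) = (InnerProductSpace.rankOne ℂ m (J n)).toLinearMap := by
  rw [operatorOfTensor, TensorProduct.lift.tmul, LinearMap.mk₂_apply]

theorem rankOne_tmul_tmul (a b : M) (c d : N) :
    (InnerProductSpace.rankOne ℂ (a ⊗ₜ[ℂ] c) (b ⊗ₜ[ℂ] d)).toLinearMap =
      TensorProduct.map (InnerProductSpace.rankOne ℂ a b).toLinearMap
        (InnerProductSpace.rankOne ℂ c d).toLinearMap := by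
  ext p q
  simp [TensorProduct.smul_tmul', smul_smul, mul_comm]

theorem operatorOfTensor_lTensor (J : N ≃ₗᵢ⋆[ℂ] N) (W : N ≃ₗᵢ[ℂ] N) (x : M ⊗[ℂ] N) :
    operatorOfTensor J ((J.trans (W.symm.trans J.symm)).lTensor M x) =
      operatorOfTensor J x ∘ₗ W.toLinearEquiv.toLinearMap := by
  induction x with
  | zero => simp
  | add x y hx hy => rw [map_add, map_add, hx, hy, map_add, LinearMap.add_comp]
  | tmul m n =>
    ext z
    simp [operatorOfTensor_tmul, LinearIsometryEquiv.inner_map_eq_flip]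

variable [FiniteDimensional ℂ M] [FiniteDimensional ℂ N]

theorem operatorOfTensor_tmul_comp_adjoint (J : N ≃ₗᵢ⋆[ℂ] N) (a b : M) (c d : N) :
    operatorOfTensor J (a ⊗ₜ[ℂ] c) ∘ₗ LinearMap.adjoint (operatorOfTensor J (b ⊗ₜ[ℂ] d)) =
      inner ℂ d c • (InnerProductSpace.rankOne ℂ a b).toLinearMap := by
  have hadjoint : LinearMap.adjoint (InnerProductSpace.rankOne ℂ b (J d)).toLinearMap =
      (InnerProductSpace.rankOne ℂ (J d) b).toLinearMap := by
    refine ((LinearMap.eq_adjoint_iff _ _).2 fun z w => ?_).symm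
    simp [inner_smul_left, inner_smul_right, mul_comm]
  ext z
  simp only [operatorOfTensor_tmul, hadjoint, LinearMap.comp_apply, LinearMap.smul_apply,
    ContinuousLinearMap.coe_coe, InnerProductSpace.rankOne_apply, inner_smul_right,
    inner_antiunitary_apply, smul_smul, mul_comm]

theorem trace_operatorOfTensor_comp_adjoint (J : N ≃ₗᵢ⋆[ℂ] N) (x y : M ⊗[ℂ] N) :
    LinearMap.trace ℂ M (operatorOfTensor J x ∘ₗ LinearMap.adjoint (operatorOfTensor J y)) =
      inner ℂ y x := by
  induction x with
  | zero => simp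
  | add x x' hx hx' => simp [hx, hx', LinearMap.add_comp, inner_add_right]
  | tmul a c =>
    induction y with
    | zero => simp
    | add y y' hy hy' => simp [hy, hy', LinearMap.comp_add, inner_add_left]
    | tmul b d =>
      rw [operatorOfTensor_tmul_comp_adjoint, map_smul, InnerProductSpace.trace_rankOne,
        TensorProduct.inner_tmul, smul_eq_mul, mul_comm]

end TensorVectors

section PartialTrace

variable {M N : Type u} [NormedAddCommGroup M] [InnerProductSpace ℂ M] [FiniteDimensional ℂ M]
  [NormedAddCommGroup N] [InnerProductSpace ℂ N] [FiniteDimensional ℂ N]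

theorem partialTraceRight_rankOne (J : N ≃ₗᵢ⋆[ℂ] N) (x y : M ⊗[ℂ] N) :
    partialTraceRight M N (InnerProductSpace.rankOne ℂ x y).toLinearMap =
      operatorOfTensor J x ∘ₗ LinearMap.adjoint (operatorOfTensor J y) := by
  induction x with
  | zero => simp
  | add x x' hx hx' => simp [hx, hx', LinearMap.add_comp]
  | tmul a c =>
    induction y with
    | zero => simp
    | add y y' hy hy' => simp [hy, hy', LinearMap.comp_add]
    | tmul b d =>
      rw [rankOne_tmul_tmul, partialTraceRight_map, InnerProductSpace.trace_rankOne,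
        operatorOfTensor_tmul_comp_adjoint]

theorem exists_unitary_half_sub_traceNorm_le_re_inner_lTensor (x y : M ⊗[ℂ] N) :
    ∃ V : N ≃ₗᵢ[ℂ] N,
      1 / 2 * (‖x‖ ^ 2 + ‖y‖ ^ 2 - traceNorm (partialTraceRight M N (pureState x) -
        partialTraceRight M N (pureState y))) ≤ (inner ℂ y (V.lTensor M x)).re := by
  obtain ⟨J⟩ := nonempty_antiunitary (N := N)
  set X := operatorOfTensor J x
  set Y := operatorOfTensor J y
  obtain ⟨W, hW⟩ := exists_unitary_trace_comp_eq_traceNorm (LinearMap.adjoint Y ∘ₗ X)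
  set V := J.trans (W.symm.trans J.symm)
  have hV : (inner ℂ y (V.lTensor M x)).re = traceNorm (LinearMap.adjoint Y ∘ₗ X) := by
    rw [← trace_operatorOfTensor_comp_adjoint J, operatorOfTensor_lTensor,
      LinearMap.trace_comp_comm', ← LinearMap.comp_assoc, hW, Complex.ofReal_re]
  have hnorm : ∀ z : M ⊗[ℂ] N, (LinearMap.trace ℂ M (operatorOfTensor J z ∘ₗ
      LinearMap.adjoint (operatorOfTensor J z))).re = ‖z‖ ^ 2 := by
    intro z
    rw [trace_operatorOfTensor_comp_adjoint]
    exact inner_self_eq_norm_sq (𝕜 := ℂ) z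
  refine ⟨V, ?_⟩
  rw [hV, pureState, pureState, partialTraceRight_rankOne J, partialTraceRight_rankOne J,
    ← hnorm x, ← hnorm y]
  simpa only [LinearMap.adjoint_adjoint] using half_sub_traceNorm_le_traceNorm_comp_adjoint
    (LinearMap.adjoint X) (LinearMap.adjoint Y)

end PartialTrace

noncomputable section MultiplicityUnitary

variable {G : Type v} [Group G] {H : Type u} [NormedAddCommGroup H]
  [InnerProductSpace ℂ H] {U : G →* (H ≃ₗᵢ[ℂ] H)} (D : IrrepDecomposition U)

namespace IrrepDecomposition

theorem toSector_apply (μ : D.ι) (x : H) : D.toSector μ x = D.iso x μ := rfl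

theorem toSector_ofSector (μ : D.ι) (z : D.M μ ⊗[ℂ] D.N μ) :
    D.toSector μ (D.ofSector μ z) = z := by
  simp [toSector, ofSector]

theorem inner_ofSector_right (μ : D.ι) (x : H) (z : D.M μ ⊗[ℂ] D.N μ) :
    inner ℂ x (D.ofSector μ z) = inner ℂ (D.toSector μ x) z := by
  rw [← D.iso.inner_map_map, PiLp.inner_apply, Finset.sum_eq_single μ]
  · simp [toSector, ofSector]
  · intro ν _ hν
    simp [ofSector, Pi.single_eq_of_ne hν]
  · simp

theorem sum_norm_toSector_sq (x : H) : ∑ μ, ‖D.toSector μ x‖ ^ 2 = ‖x‖ ^ 2 := by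
  simp only [toSector_apply, ← PiLp.norm_sq_eq_of_L2, D.iso.norm_map]

theorem sum_inner_toSector (x y : H) :
    ∑ μ, inner ℂ (D.toSector μ x) (D.toSector μ y) = inner ℂ x y := by
  rw [← D.iso.inner_map_map, PiLp.inner_apply]
  rfl

theorem reduction_pureState (ψ : H) (μ : D.ι) :
    D.reduction (pureState ψ) μ =
      partialTraceRight (D.M μ) (D.N μ) (pureState (D.toSector μ ψ)) := by
  rw [reduction]
  congr 1
  ext z
  simp [sectorProj, toSector_ofSector, pureState, inner_ofSector_right]

/-- The unitary `⨁_μ 1 ⊗ W_μ` acting on the multiplicity spaces. -/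
def multiplicityUnitary (W : ∀ μ, D.N μ ≃ₗᵢ[ℂ] D.N μ) : H ≃ₗᵢ[ℂ] H :=
  (D.iso.trans (LinearIsometryEquiv.piLpCongrRight 2 fun μ => (W μ).lTensor (D.M μ))).trans
    D.iso.symm

theorem toSector_multiplicityUnitary (W : ∀ μ, D.N μ ≃ₗᵢ[ℂ] D.N μ) (x : H) (μ : D.ι) :
    D.toSector μ (D.multiplicityUnitary W x) = (W μ).lTensor (D.M μ) (D.toSector μ x) := by
  simp [toSector_apply, multiplicityUnitary]

theorem isGInvariantUnitary_multiplicityUnitary (W : ∀ μ, D.N μ ≃ₗᵢ[ℂ] D.N μ) :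
    IsGInvariantUnitary U (D.multiplicityUnitary W) := by
  intro g
  ext x
  refine D.iso.injective (PiLp.ext fun μ => ?_)
  change D.toSector μ (D.multiplicityUnitary W (U g x)) =
    D.iso (U g (D.multiplicityUnitary W x)) μ
  rw [toSector_multiplicityUnitary, toSector_apply, D.iso_apply, D.iso_apply, ← toSector_apply,
    ← toSector_apply, toSector_multiplicityUnitary]
  exact LinearMap.congr_fun ((LinearMap.lTensor_comp_rTensor (D.M μ) _ _).trans
    (LinearMap.rTensor_comp_lTensor (D.M μ) _ _).symm) (D.toSector μ x)

theorem exists_isGInvariantUnitary_half_sub_le_re_inner (ψ₁ ψ₂ : H) :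
    ∃ V : H ≃ₗᵢ[ℂ] H, IsGInvariantUnitary U V ∧
      1 / 2 * (‖ψ₁‖ ^ 2 + ‖ψ₂‖ ^ 2 -
        ∑ μ, traceNorm (D.reduction (pureState ψ₁) μ - D.reduction (pureState ψ₂) μ)) ≤
          (inner ℂ ψ₂ (V ψ₁)).re := by
  choose W hW using fun μ => exists_unitary_half_sub_traceNorm_le_re_inner_lTensor
    (D.toSector μ ψ₁) (D.toSector μ ψ₂)
  refine ⟨D.multiplicityUnitary W, D.isGInvariantUnitary_multiplicityUnitary W, ?_⟩
  rw [← D.sum_norm_toSector_sq ψ₁, ← D.sum_norm_toSector_sq ψ₂, ← D.sum_inner_toSector,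
    ← Finset.sum_add_distrib, ← Finset.sum_sub_distrib, Finset.mul_sum, Complex.re_sum]
  simp only [reduction_pureState, toSector_multiplicityUnitary]
  exact Finset.sum_le_sum fun μ _ => hW μ

end IrrepDecomposition

end MultiplicityUnitary

section UnitaryEquivalence

theorem exists_eq_smul_id_of_isIrreducible {k G V : Type*} [Field k] [IsAlgClosed k] [Monoid G]
    [AddCommGroup V] [Module k V] [FiniteDimensional k V] {ρ : Representation k G V}
    (hρ : ρ.IsIrreducible) {S : V →ₗ[k] V} (hS : ∀ g, S ∘ₗ ρ g = ρ g ∘ₗ S) :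
    ∃ c : k, S = c • LinearMap.id := by
  let f : Representation.IntertwiningMap ρ ρ := ⟨S, hS⟩
  obtain ⟨c, hc⟩ :=
    Representation.IsIrreducible.algebraMap_intertwiningMap_bijective_of_isAlgClosed.2 f
  refine ⟨c, ?_⟩
  change f.toLinearMap = _
  rw [← hc]
  rfl

theorem nontrivial_of_isIrreducible {k G V : Type*} [Field k] [Monoid G] [AddCommGroup V]
    [Module k V] {ρ : Representation k G V} (hρ : ρ.IsIrreducible) : Nontrivial V := by
  have := Subrepresentation.toSubmodule_injective (ρ := ρ).nontrivial
  exact (Submodule.nontrivial_iff k).1 this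

variable {G : Type*} [Group G] {H K L : Type*}
  [NormedAddCommGroup H] [InnerProductSpace ℂ H] [NormedAddCommGroup K] [InnerProductSpace ℂ K]
  [NormedAddCommGroup L] [InnerProductSpace ℂ L]

/-- The unitary `e` intertwines two unitary representations, i.e. is a unitary equivalence between
them. -/
def IsUnitaryIntertwiner (U : G →* (H ≃ₗᵢ[ℂ] H)) (U' : G →* (K ≃ₗᵢ[ℂ] K))
    (e : H ≃ₗᵢ[ℂ] K) : Prop :=
  ∀ g x, e (U g x) = U' g (e x)

variable {U : G →* (H ≃ₗᵢ[ℂ] H)} {U' : G →* (K ≃ₗᵢ[ℂ] K)} {U'' : G →* (L ≃ₗᵢ[ℂ] L)}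

theorem IsUnitaryIntertwiner.refl (U : G →* (H ≃ₗᵢ[ℂ] H)) :
    IsUnitaryIntertwiner U U (.refl ℂ H) :=
  fun _ _ => rfl

theorem IsUnitaryIntertwiner.symm {e : H ≃ₗᵢ[ℂ] K} (he : IsUnitaryIntertwiner U U' e) :
    IsUnitaryIntertwiner U' U e.symm := fun g x => by
  rw [LinearIsometryEquiv.symm_apply_eq, he, LinearIsometryEquiv.apply_symm_apply]

theorem IsUnitaryIntertwiner.trans {e : H ≃ₗᵢ[ℂ] K} {f : K ≃ₗᵢ[ℂ] L}
    (he : IsUnitaryIntertwiner U U' e) (hf : IsUnitaryIntertwiner U' U'' f) :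
    IsUnitaryIntertwiner U U'' (e.trans f) := fun g x => by
  simp only [LinearIsometryEquiv.trans_apply, he g x, hf g (e x)]

theorem inner_unitaryRep_apply_left (U : G →* (H ≃ₗᵢ[ℂ] H)) (g : G) (x y : H) :
    inner ℂ (U g x) y = inner ℂ x (U g⁻¹ y) := by
  rw [map_inv, LinearIsometryEquiv.inv_def, LinearIsometryEquiv.inner_map_eq_flip]

variable [FiniteDimensional ℂ H] [FiniteDimensional ℂ K]

theorem exists_norm_apply_eq_mul_norm_of_isIrreducible
    (hU : (unitaryRepToRepresentation U).IsIrreducible) (T : H →ₗ[ℂ] K)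
    (hT : ∀ g x, T (U g x) = U' g (T x)) : ∃ r : ℝ, 0 ≤ r ∧
      ∀ x, ‖T x‖ = r * ‖x‖ := by
  have hcomm : ∀ g, (LinearMap.adjoint T ∘ₗ T) ∘ₗ unitaryRepToRepresentation U g =
      unitaryRepToRepresentation U g ∘ₗ LinearMap.adjoint T ∘ₗ T := by
    refine fun g => LinearMap.ext fun x => ext_inner_right ℂ fun y => ?_
    change inner ℂ (LinearMap.adjoint T (T (U g x))) y =
      inner ℂ (U g (LinearMap.adjoint T (T x))) y
    rw [inner_unitaryRep_apply_left, LinearMap.adjoint_inner_left, LinearMap.adjoint_inner_left,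
      hT, hT, inner_unitaryRep_apply_left]
  obtain ⟨c, hc⟩ := exists_eq_smul_id_of_isIrreducible hU hcomm
  have hsq : ∀ x, ‖T x‖ ^ 2 = ‖x‖ ^ 2 * ‖c‖ := fun x => by
    have h : inner ℂ (T x) (T x) = inner ℂ (c • x) x := by
      rw [← LinearMap.adjoint_inner_left, ← LinearMap.comp_apply, hc]
      rfl
    simpa [inner_smul_left, inner_self_eq_norm_sq_to_K] using congrArg norm h
  refine ⟨√‖c‖, Real.sqrt_nonneg _, fun x => ?_⟩
  rw [← Real.sqrt_sq (norm_nonneg (T x)), hsq, Real.sqrt_mul (sq_nonneg _),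
    Real.sqrt_sq (norm_nonneg x), mul_comm]

theorem exists_isUnitaryIntertwiner_of_equiv
    (hU : (unitaryRepToRepresentation U).IsIrreducible)
    (φ : (unitaryRepToRepresentation U).Equiv (unitaryRepToRepresentation U')) :
    ∃ e : H ≃ₗᵢ[ℂ] K, IsUnitaryIntertwiner U U' e := by
  let T : H ≃ₗ[ℂ] K := φ.toLinearEquiv
  have hT : ∀ g x, T (U g x) = U' g (T x) :=
    Representation.IntertwiningMap.isIntertwining _ _ φ.toIntertwiningMap
  obtain ⟨r, hr_nonneg, hr⟩ :=
    exists_norm_apply_eq_mul_norm_of_isIrreducible hU T.toLinearMap hT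
  have := nontrivial_of_isIrreducible hU
  obtain ⟨x₀, hx₀⟩ := exists_ne (0 : H)
  have hr_ne : r ≠ 0 := by
    rintro rfl
    exact hx₀ (T.map_eq_zero_iff.1 (norm_eq_zero.1 ((hr x₀).trans (zero_mul _))))
  have hc : (r⁻¹ : ℂ) ≠ 0 := inv_ne_zero (Complex.ofReal_ne_zero.2 hr_ne)
  refine ⟨⟨T.trans (LinearEquiv.smulOfNeZero ℂ K _ hc), fun x => ?_⟩, fun g x => ?_⟩
  · change ‖(r⁻¹ : ℂ) • T x‖ = ‖x‖
    rw [norm_smul, norm_inv, Complex.norm_of_nonneg hr_nonneg]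
    exact (congrArg _ (hr x)).trans (inv_mul_cancel_left₀ hr_ne _)
  · change (r⁻¹ : ℂ) • T (U g x) = U' g ((r⁻¹ : ℂ) • T x)
    rw [hT, map_smul]

end UnitaryEquivalence

noncomputable section InvariantSubspaces

variable {G H : Type*} [Group G] [NormedAddCommGroup H] [InnerProductSpace ℂ H]

/-- The subspace `W` is invariant under the unitary representation `U`. -/
def IsInvariantSubspace (U : G →* (H ≃ₗᵢ[ℂ] H)) (W : Submodule ℂ H) : Prop :=
  ∀ g, ∀ x ∈ W, U g x ∈ W

/-- A minimal nonzero invariant subspace. -/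
structure IsMinimalInvariantSubspace (U : G →* (H ≃ₗᵢ[ℂ] H)) (W : Submodule ℂ H) : Prop where
  invariant : IsInvariantSubspace U W
  ne_bot : W ≠ ⊥
  eq_bot_or_eq : ∀ W' ≤ W, IsInvariantSubspace U W' → W' = ⊥ ∨ W' = W

theorem IsInvariantSubspace.orthogonal {U : G →* (H ≃ₗᵢ[ℂ] H)} {W : Submodule ℂ H}
    (hW : IsInvariantSubspace U W) : IsInvariantSubspace U Wᗮ := by
  intro g x hx
  rw [Submodule.mem_orthogonal'] at hx ⊢
  intro w hw
  rw [inner_unitaryRep_apply_left]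
  exact hx _ (hW _ _ hw)

theorem IsInvariantSubspace.inf {U : G →* (H ≃ₗᵢ[ℂ] H)} {W W' : Submodule ℂ H}
    (hW : IsInvariantSubspace U W) (hW' : IsInvariantSubspace U W') :
    IsInvariantSubspace U (W ⊓ W') :=
  fun g x hx => ⟨hW g x hx.1, hW' g x hx.2⟩

/-- The restriction of a unitary representation to an invariant subspace. -/
def restrictUnitaryRep (U : G →* (H ≃ₗᵢ[ℂ] H)) (W : Submodule ℂ H)
    (hW : IsInvariantSubspace U W) : G →* (W ≃ₗᵢ[ℂ] W) where
  toFun g :=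
    { toLinearEquiv := LinearEquiv.ofLinearMap
        ((U g).toLinearEquiv.toLinearMap.restrict (hW g))
        ((U g⁻¹).toLinearEquiv.toLinearMap.restrict (hW g⁻¹))
        (by
          ext x
          change (U g * U g⁻¹) x = x
          rw [← map_mul]; simp)
        (by
          ext x
          change (U g⁻¹ * U g) x = x
          rw [← map_mul]; simp)
      norm_map' := fun x => (U g).norm_map x }
  map_one' := by
    ext x
    change U 1 x = x
    simp
  map_mul' g h := by
    ext x
    change U (g * h) x = U g (U h x)
    rw [map_mul]; rfl

theorem IsMinimalInvariantSubspace.isIrreducible {U : G →* (H ≃ₗᵢ[ℂ] H)} {W : Submodule ℂ H}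
    (hW : IsMinimalInvariantSubspace U W) :
    (unitaryRepToRepresentation (restrictUnitaryRep U W hW.invariant)).IsIrreducible := by
  have hne := (Submodule.nontrivial_iff_ne_bot).2 hW.ne_bot
  refine { exists_pair_ne := ⟨⊥, ⊤, fun h => ?_⟩, eq_bot_or_eq_top := fun a => ?_ }
  · exact (bot_ne_top : (⊥ : Submodule ℂ W) ≠ ⊤) (congrArg Subrepresentation.toSubmodule h)
  · have hinv : IsInvariantSubspace U (a.toSubmodule.map W.subtype) := by
      rintro g _ ⟨y, hy, rfl⟩
      exact ⟨_, a.apply_mem_toSubmodule g hy, rfl⟩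
    have hmap := (Submodule.map_injective_of_injective W.subtype_injective).comp
      (Subrepresentation.toSubmodule_injective
        (ρ := unitaryRepToRepresentation (restrictUnitaryRep U W hW.invariant)))
    exact (hW.eq_bot_or_eq _ (Submodule.map_subtype_le _ _) hinv).imp
      (fun h => hmap (h.trans (Submodule.map_bot _).symm))
      (fun h => hmap (h.trans (Submodule.map_subtype_top W).symm))

theorem IsInvariantSubspace.exists_isMinimalInvariantSubspace_le [FiniteDimensional ℂ H]
    {U : G →* (H ≃ₗᵢ[ℂ] H)} {W : Submodule ℂ H} (hW : IsInvariantSubspace U W) (hne : W ≠ ⊥) :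
    ∃ A ≤ W, IsMinimalInvariantSubspace U A := by
  obtain ⟨A, ⟨hAW, hA, hA0⟩, hmin⟩ :=
    (wellFounded_lt (α := Submodule ℂ H)).has_min
      {A | A ≤ W ∧ IsInvariantSubspace U A ∧ A ≠ ⊥} ⟨W, le_rfl, hW, hne⟩
  refine ⟨A, hAW, hA, hA0, fun B hBA hB => ?_⟩
  by_contra! h
  exact hmin B ⟨hBA.trans hAW, hB, h.1⟩ (lt_of_le_of_ne hBA h.2)

theorem IsInvariantSubspace.exists_finset_sup_eq [FiniteDimensional ℂ H]
    {U : G →* (H ≃ₗᵢ[ℂ] H)} {W : Submodule ℂ H} (hW : IsInvariantSubspace U W) :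
    ∃ s : Finset (Submodule ℂ H), (∀ A ∈ s, IsMinimalInvariantSubspace U A) ∧
      (s : Set (Submodule ℂ H)).Pairwise (· ⟂ ·) ∧ s.sup id = W := by
  classical
  induction W using (wellFounded_lt (α := Submodule ℂ H)).induction with
  | _ W ih =>
    by_cases hne : W = ⊥
    · exact ⟨∅, by simp, by simp, by simp [hne]⟩
    obtain ⟨A, hAW, hA⟩ := hW.exists_isMinimalInvariantSubspace_le hne
    have hsup : A ⊔ Aᗮ ⊓ W = W := Submodule.sup_orthogonal_inf_of_hasOrthogonalProjection hAW
    have hlt : Aᗮ ⊓ W < W := by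
      refine lt_of_le_of_ne inf_le_right fun h => hA.ne_bot ?_
      have h1 : A ≤ Aᗮ := hAW.trans (inf_eq_right.1 h)
      exact Submodule.isOrtho_self.1 h1
    obtain ⟨s, hs, hpair, hsW⟩ := ih _ hlt (hA.invariant.orthogonal.inf hW)
    refine ⟨insert A s, ?_, ?_, ?_⟩
    · intro B hB
      rcases Finset.mem_insert.1 hB with rfl | hB
      exacts [hA, hs B hB]
    · rw [Finset.coe_insert, Set.pairwise_insert]
      refine ⟨hpair, fun B hB _ => ?_⟩
      rw [Submodule.isOrtho_comm (U := B), and_self]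
      have hB' : B ≤ Aᗮ := ((Finset.le_sup (f := id) hB).trans hsW.le).trans inf_le_left
      exact (Submodule.isOrtho_iff_le.2 hB').symm
    · rw [Finset.sup_insert, hsW, id, hsup]

theorem isometryL2OfOrthogonalFamily_unitaryRep_apply {κ : Type*} [Fintype κ] [DecidableEq κ]
    {U : G →* (H ≃ₗᵢ[ℂ] H)} {W : κ → Submodule ℂ H} [∀ j, CompleteSpace (W j)]
    (hW : ∀ j, IsInvariantSubspace U (W j)) (hint : DirectSum.IsInternal W)
    (horth : OrthogonalFamily ℂ (fun j => W j) fun j => (W j).subtypeₗᵢ) (g : G) (x : H) (j : κ) :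
    hint.isometryL2OfOrthogonalFamily horth (U g x) j =
      restrictUnitaryRep U (W j) (hW j) g (hint.isometryL2OfOrthogonalFamily horth x j) := by
  set Ψ := hint.isometryL2OfOrthogonalFamily horth
  have h : Ψ.symm (WithLp.toLp 2 fun j => restrictUnitaryRep U (W j) (hW j) g (Ψ x j)) = U g x := by
    rw [hint.isometryL2OfOrthogonalFamily_symm_apply horth]
    conv_rhs => rw [← Ψ.symm_apply_apply x,
      hint.isometryL2OfOrthogonalFamily_symm_apply horth, map_sum]
    rfl
  rw [← h, LinearIsometryEquiv.apply_symm_apply]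

theorem exists_isometry_piLp_isMinimalInvariantSubspace [FiniteDimensional ℂ H]
    (U : G →* (H ≃ₗᵢ[ℂ] H)) :
    ∃ (s : Finset (Submodule ℂ H)) (hs : ∀ A : s, IsMinimalInvariantSubspace U A.1)
      (Ψ : H ≃ₗᵢ[ℂ] PiLp 2 fun A : s => A.1), ∀ g x A,
        Ψ (U g x) A = restrictUnitaryRep U A.1 (hs A).invariant g (Ψ x A) := by
  classical
  obtain ⟨s, hs, hpair, hsup⟩ :=
    IsInvariantSubspace.exists_finset_sup_eq (U := U) (W := ⊤) fun _ _ _ => trivial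
  have horth : OrthogonalFamily ℂ (fun A : s => A.1) fun A => A.1.subtypeₗᵢ :=
    OrthogonalFamily.of_pairwise fun A B hAB => hpair A.2 B.2 fun h => hAB (Subtype.ext h)
  have hint : DirectSum.IsInternal fun A : s => A.1 := by
    have hiSup : ⨆ A : s, A.1 = ⊤ := by
      rw [← hsup, Finset.sup_eq_iSup, iSup_subtype]
      rfl
    rw [horth.isInternal_iff, hiSup, Submodule.top_orthogonal_eq_bot]
  have hinv : ∀ A : s, IsInvariantSubspace U A.1 := fun A => (hs A.1 A.2).invariant
  refine ⟨s, fun A => hs A.1 A.2, hint.isometryL2OfOrthogonalFamily horth, fun g x A => ?_⟩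
  exact isometryL2OfOrthogonalFamily_unitaryRep_apply (W := fun A : s => A.1) hinv hint horth g x A

end InvariantSubspaces

noncomputable section GroupFibers

variable {κ ι : Type*} [Fintype κ] [DecidableEq ι] (f : κ → ι)
  {W : κ → Type*} [∀ j, NormedAddCommGroup (W j)] [∀ j, InnerProductSpace ℂ (W j)]
  {M : ι → Type*} [∀ μ, NormedAddCommGroup (M μ)] [∀ μ, InnerProductSpace ℂ (M μ)]
  (u : ∀ (μ : ι) (j : {j // f j = μ}), W j.1 ≃ₗᵢ[ℂ] M μ)

/-- If the spaces `W j` with `f j = μ` are all identified with `M μ`, then the direct sum of the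
`W j` is the direct sum of the `M μ ⊗ ℂ^(f⁻¹ μ)`: the underlying linear map. -/
def groupFibers :
    PiLp 2 W →ₗ[ℂ] PiLp 2 (fun μ => M μ ⊗[ℂ] EuclideanSpace ℂ {j // f j = μ}) where
  toFun y := WithLp.toLp 2 fun μ =>
    ∑ j, u μ j (y j.1) ⊗ₜ[ℂ] EuclideanSpace.basisFun {j // f j = μ} ℂ j
  map_add' x y := by
    ext μ
    simp only [PiLp.add_apply, map_add, TensorProduct.add_tmul, Finset.sum_add_distrib]
  map_smul' c x := by
    ext μ
    simp only [PiLp.smul_apply, map_smul, ← TensorProduct.smul_tmul', Finset.smul_sum,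
      RingHom.id_apply]

theorem groupFibers_apply (y : PiLp 2 W) (μ : ι) :
    groupFibers f u y μ =
      ∑ j, u μ j (y j.1) ⊗ₜ[ℂ] EuclideanSpace.basisFun {j // f j = μ} ℂ j := rfl

variable [Fintype ι]

theorem norm_groupFibers (y : PiLp 2 W) : ‖groupFibers f u y‖ = ‖y‖ := by
  have h : ‖groupFibers f u y‖ ^ 2 = ‖y‖ ^ 2 := by
    rw [PiLp.norm_sq_eq_of_L2, PiLp.norm_sq_eq_of_L2]
    simp only [groupFibers_apply, norm_sum_tmul_orthonormalBasis_sq,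
      LinearIsometryEquiv.norm_map]
    exact Fintype.sum_fiberwise f fun j => ‖y j‖ ^ 2
  exact (sq_eq_sq₀ (norm_nonneg _) (norm_nonneg _)).1 h

variable [∀ j, FiniteDimensional ℂ (W j)] [∀ μ, FiniteDimensional ℂ (M μ)]

/-- The map `groupFibers` as a unitary. -/
def groupFibersIsometry :
    PiLp 2 W ≃ₗᵢ[ℂ] PiLp 2 (fun μ => M μ ⊗[ℂ] EuclideanSpace ℂ {j // f j = μ}) :=
  LinearIsometry.toLinearIsometryEquiv ⟨groupFibers f u, norm_groupFibers f u⟩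
    (by
      rw [(WithLp.linearEquiv 2 ℂ (∀ j, W j)).finrank_eq,
        (WithLp.linearEquiv 2 ℂ (∀ μ, M μ ⊗[ℂ] EuclideanSpace ℂ {j // f j = μ})).finrank_eq,
        Module.finrank_pi_fintype, Module.finrank_pi_fintype, ← Fintype.sum_fiberwise f]
      refine Finset.sum_congr rfl fun μ _ => ?_
      rw [Module.finrank_tensorProduct, finrank_euclideanSpace,
        Finset.sum_congr rfl fun j _ => (u μ j).toLinearEquiv.finrank_eq]
      simp [mul_comm])

theorem groupFibersIsometry_apply (y : PiLp 2 W) (μ : ι) :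
    groupFibersIsometry f u y μ =
      ∑ j, u μ j (y j.1) ⊗ₜ[ℂ] EuclideanSpace.basisFun {j // f j = μ} ℂ j := rfl

theorem groupFibersIsometry_unitaryRep_apply {G : Type*} [Group G]
    {R : ∀ j, G →* (W j ≃ₗᵢ[ℂ] W j)} {S : ∀ μ, G →* (M μ ≃ₗᵢ[ℂ] M μ)}
    (hu : ∀ μ j, IsUnitaryIntertwiner (R j.1) (S μ) (u μ j)) {g : G} {y z : PiLp 2 W}
    (hz : ∀ j, z j = R j g (y j)) (μ : ι) :
    groupFibersIsometry f u z μ = TensorProduct.map (S μ g).toLinearEquiv.toLinearMap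
      LinearMap.id (groupFibersIsometry f u y μ) := by
  rw [groupFibersIsometry_apply, groupFibersIsometry_apply, map_sum]
  refine Finset.sum_congr rfl fun j _ => ?_
  rw [hz, hu μ j]
  rfl

end GroupFibers

noncomputable section IsotypicDecomposition

variable {G : Type v} [Group G] {H : Type u} [NormedAddCommGroup H] [InnerProductSpace ℂ H]

/-- Unitary equivalence of the members of a family of unitary representations, as an equivalence
relation on the index type. -/
def unitaryEquivalence {κ : Type*} {W : κ → Type*} [∀ j, NormedAddCommGroup (W j)]
    [∀ j, InnerProductSpace ℂ (W j)] (R : ∀ j, G →* (W j ≃ₗᵢ[ℂ] W j)) : Setoid κ where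
  r i j := ∃ e : W i ≃ₗᵢ[ℂ] W j, IsUnitaryIntertwiner (R i) (R j) e
  iseqv :=
    { refl := fun j => ⟨_, .refl (R j)⟩
      symm := fun ⟨_, he⟩ => ⟨_, he.symm⟩
      trans := fun ⟨_, he⟩ ⟨_, hf⟩ => ⟨_, he.trans hf⟩ }

theorem nonempty_irrepDecomposition_of_isometry_piLp {κ : Type u} [Fintype κ] {W : κ → Type u}
    [∀ j, NormedAddCommGroup (W j)] [∀ j, InnerProductSpace ℂ (W j)]
    [∀ j, FiniteDimensional ℂ (W j)] {U : G →* (H ≃ₗᵢ[ℂ] H)} {R : ∀ j, G →* (W j ≃ₗᵢ[ℂ] W j)}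
    (hR : ∀ j, (unitaryRepToRepresentation (R j)).IsIrreducible) (Ψ : H ≃ₗᵢ[ℂ] PiLp 2 W)
    (hΨ : ∀ g x j, Ψ (U g x) j = R j g (Ψ x j)) : Nonempty (IrrepDecomposition U) := by
  classical
  let Label := Quotient (unitaryEquivalence R)
  let label : κ → Label := Quotient.mk _
  have hlabel : ∀ (μ : Label) (j : {j // label j = μ}),
      ∃ e : W j.1 ≃ₗᵢ[ℂ] W μ.out, IsUnitaryIntertwiner (R j.1) (R μ.out) e :=
    fun μ j => Quotient.exact (j.2.trans μ.out_eq.symm)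
  choose u hu using hlabel
  exact ⟨{
    ι := Label
    M := fun μ => W μ.out
    N := fun μ => EuclideanSpace ℂ {j // label j = μ}
    irrep := fun μ => R μ.out
    irreducible := fun μ => hR μ.out
    inequivalent := fun μ ν hμν => ⟨fun φ => hμν <| Quotient.out_equiv_out.1 <|
      exists_isUnitaryIntertwiner_of_equiv (hR μ.out) φ⟩
    iso := Ψ.trans (groupFibersIsometry label u)
    iso_apply := fun g x => groupFibersIsometry_unitaryRep_apply label u hu (hΨ g x) }⟩

theorem nonempty_irrepDecomposition [FiniteDimensional ℂ H] (U : G →* (H ≃ₗᵢ[ℂ] H)) :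
    Nonempty (IrrepDecomposition U) := by
  obtain ⟨s, hs, Ψ, hΨ⟩ := exists_isometry_piLp_isMinimalInvariantSubspace U
  exact nonempty_irrepDecomposition_of_isometry_piLp (fun A => (hs A).isIrreducible) Ψ hΨ

end IsotypicDecomposition

theorem mainTheorem8 {G : Type v} [Group G] {H : Type u} [NormedAddCommGroup H]
    [InnerProductSpace ℂ H] [FiniteDimensional ℂ H] (U : G →* (H ≃ₗᵢ[ℂ] H)) :
    Nonempty (IrrepDecomposition U) ∧
    ∀ (D : IrrepDecomposition U) (ψ₁ ψ₂ : H), ‖ψ₁‖ = 1 → ‖ψ₂‖ = 1 →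
      ∃ V : H ≃ₗᵢ[ℂ] H, IsGInvariantUnitary U V ∧
        1 - 1 / 2 * ∑ μ, traceNorm (D.reduction (pureState ψ₁) μ - D.reduction (pureState ψ₂) μ)
          ≤ ‖inner ℂ ψ₂ (V ψ₁)‖ := by
  refine ⟨nonempty_irrepDecomposition U, fun D ψ₁ ψ₂ h₁ h₂ => ?_⟩
  obtain ⟨V, hV, hle⟩ := D.exists_isGInvariantUnitary_half_sub_le_re_inner ψ₁ ψ₂
  refine ⟨V, hV, le_trans ?_ (Complex.re_le_norm _)⟩
  rw [h₁, h₂] at hle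
  linarith
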